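/- Let $n\ge 1$, $W=S_n$, $s_i=(i\ \,i{+}1)$, let $\ell(w)$ be the number of inversions of $w$, and let $w_0(i)=n+1-i$; write $ws_i>w$ when $\ell(ws_i)>\ell(w)$. Put $\boldsymbol{x}=(x_1,\dots,x_n)$, $\boldsymbol{y}=(y_1,\dots,y_n)$, $\boldsymbol{y}_{w_0}=(y_n,\dots,y_1)$, $\boldsymbol{x}^{\alpha_i}=x_i/x_{i+1}$, and for $1\le i\le n-1$ let $$T_i=\frac{-1+t}{1-\boldsymbol{x}^{-\alpha_i}}+\frac{1-t\boldsymbol{x}^{\alpha_i}}{1-\boldsymbol{x}^{-\alpha_i}}\,s_i ,$$ where $s_i$ exchanges $x_i$ and $x_{i+1}$ and fixes $t$ and $\boldsymbol{y}$. **Lifted double motivic Chern classes.** These are the elements of $\mathbb{C}[t^{\pm1},\boldsymbol{x}^{\pm1},\boldsymbol{y}^{\pm1}]$ determined by $$\mathrm{MC}(X(1_W)^\circ)=\prod_{i<j}\Bigl(1-\frac{x_i}{y_j}\Bigr),\qquad \mathrm{MC}(X(ws_i)^\circ)=T_i\,\mathrm{MC}(X(w)^\circ)\ \text{ if } ws_i>w,$$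 $$\mathrm{MC}(Y(w_0)^\circ)=\prod_{i+j\le n}\Bigl(1-\frac{x_i}{y_j}\Bigr),\qquad \mathrm{MC}(Y(ws_i)^\circ)=T_i\,\mathrm{MC}(Y(w)^\circ)\ \text{ if } ws_i<w.$$ **Lattice model.** Consider the $n\times n$ square grid with rows $1,\dots,n$ from top to bottom and columns $1,\dots,n$ from right to left. The colors are $1<\dots<n$. A horizontal edge is labelled by a color or by $+$ (no color), a vertical edge by a set of colors. For $\sigma,w\in W$ the boundary conditions are: the top edge of column $j$ is labelled $\{\sigma(j)\}$, the right edge of row $i$ is labelled $w(i)$, the bottom edges are labelled $\emptyset$ and the left edges $+$. A vertex in row $i$ and column $j$ has parameters $x=x_i$, $y=y_j$; its labels (left, top, right, bottom) must be one of the following, with the indicated weight. Here $c<d$, $\Sigma$ is a set of colors, $|\Sigma_I|$ is the number of elements of $\Sigma$ in the interval $I$, and $\Sigma_c=\Sigma\cap\{c\}$. 1. $(+,\Sigma,+,\Sigma)$: $(-tx)^{|\Sigma|}$. 2. $(c,\Sigma,c,\Sigma)$: $t^{|\Sigma_{(c,n]}|}x^{|\Sigma|}\bigl(-x^{-1}+t^{|\Sigma_c|}y^{-1}\bigr)$.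 3. $(+,\Sigma,c,\Sigma\setminus\{c\})$ with $c\in\Sigma$: $(-t)^{|\Sigma_{[1,c)}|}t^{|\Sigma_{(c,n]}|}x^{|\Sigma|-1}$. 4. $(c,\Sigma,+,\Sigma\cup\{c\})$ with $c\notin\Sigma$: $(t-1)x^{-1}(-t)^{|\Sigma_{(c,n]}|}x^{|\Sigma|+1}$. 5. $(c,\Sigma,d,(\Sigma\cup\{c\})\setminus\{d\})$ with $c\notin\Sigma$, $d\in\Sigma$: $(t-1)x^{-1}(-t)^{|\Sigma_{(c,d)}|}t^{|\Sigma_{(d,n]}|}x^{|\Sigma|}$. 6. $(d,\Sigma,c,(\Sigma\cup\{d\})\setminus\{c\})$ with $d\notin\Sigma$, $c\in\Sigma$: $(t-1)y^{-1}(-1)^{|\Sigma_{(c,d)}|}t^{|\Sigma_{(d,n]}|}x^{|\Sigma|}$. The partition function $\widetilde Z^\square_{\sigma,w}(\boldsymbol{x};\boldsymbol{y})$ is the sum, over all labellings of the edges that satisfy the boundary conditions and have only vertices as listed, of the product of the weights of all $n^2$ vertices. **Statement.** The two recursions above are consistent, that is, each of the families $(\mathrm{MC}(X(w)^\circ))_{w\in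 W}$ and $(\mathrm{MC}(Y(w)^\circ))_{w\in W}$ of Laurent polynomials exists and is unique, and for all $w\in W$ $$\mathrm{MC}(X(w)^\circ)=(-1)^{\ell(w_0)}\,\widetilde Z^\square_{1_W,\,w_0w}(\boldsymbol{x};\boldsymbol{y}_{w_0})\qquad\text{and}\qquad \mathrm{MC}(Y(w)^\circ)=(-1)^{\ell(w_0)}\,\widetilde Z^\square_{1_W,\,w}(\boldsymbol{x};\boldsymbol{y}).$$ -/

import Mathlib

open Equiv Finset

namespace MotivicLattice

/-! ### Permutations -/

/-- The length of a permutation: its number of inversions. -/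
def permLength {n : ℕ} (w : Perm (Fin n)) : ℕ :=
  (univ.filter fun p : Fin n × Fin n => p.1 < p.2 ∧ w p.2 < w p.1).card

/-- The longest permutation, which reverses the order. -/
def longest (n : ℕ) : Perm (Fin n) := Fin.revPerm

/-! ### Laurent polynomials and Demazure type operators -/

/-- The variables: `t`, then `x_1, …, x_n`, then `y_1, …, y_n`. -/
abbrev Var (n : ℕ) : Type := Unit ⊕ (Fin n ⊕ Fin n)

/-- The field of rational functions `ℂ(t, x_1, …, x_n, y_1, …, y_n)`. -/
abbrev RatFun (n : ℕ) : Type := FractionRing (MvPolynomial (Var n) ℂ)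

noncomputable section

/-- The variable `t`. -/
def tVar (n : ℕ) : RatFun n :=
  algebraMap (MvPolynomial (Var n) ℂ) (RatFun n) (MvPolynomial.X (Sum.inl ()))

/-- The variable `x_i`. -/
def xVar {n : ℕ} (i : Fin n) : RatFun n :=
  algebraMap (MvPolynomial (Var n) ℂ) (RatFun n) (MvPolynomial.X (Sum.inr (Sum.inl i)))

/-- The variable `y_j`. -/
def yVar {n : ℕ} (j : Fin n) : RatFun n :=
  algebraMap (MvPolynomial (Var n) ℂ) (RatFun n) (MvPolynomial.X (Sum.inr (Sum.inr j)))

/-- The ring `ℂ[t, t⁻¹, x_i, x_i⁻¹, y_j, y_j⁻¹]` of Laurent polynomials, inside the field of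
rational functions. -/
def laurent (n : ℕ) : Subalgebra ℂ (RatFun n) :=
  Algebra.adjoin ℂ
    ({tVar n, (tVar n)⁻¹} ∪ Set.range (xVar (n := n)) ∪ Set.range (fun i : Fin n => (xVar i)⁻¹) ∪
      Set.range (yVar (n := n)) ∪ Set.range (fun j : Fin n => (yVar j)⁻¹))

/-- The action of a permutation on rational functions through the `x` variables,
`(w · f)(x_1, …, x_n; y) = f(x_{w(1)}, …, x_{w(n)}; y)`. -/
def xAct {n : ℕ} (w : Perm (Fin n)) : RatFun n ≃ₐ[ℂ] RatFun n :=
  IsFractionRing.fieldEquivOfAlgEquiv ℂ (RatFun n) (RatFun n)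
    (MvPolynomial.renameEquiv ℂ
      (Equiv.sumCongr (Equiv.refl Unit) (Equiv.sumCongr w (Equiv.refl (Fin n)))))

theorem xAct_tVar {n : ℕ} (w : Perm (Fin n)) : xAct w (tVar n) = tVar n := by
  simp [xAct, tVar]

theorem xAct_xVar {n : ℕ} (w : Perm (Fin n)) (i : Fin n) : xAct w (xVar i) = xVar (w i) := by
  simp [xAct, xVar]

theorem xAct_yVar {n : ℕ} (w : Perm (Fin n)) (j : Fin n) : xAct w (yVar j) = yVar j := by
  simp [xAct, yVar]

/-- The operator `T_i = (-1 + t) / (1 - x^{-α_i}) + (1 - t x^{α_i}) / (1 - x^{-α_i}) s_i`, where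
`x^{α_i} = x_i / x_{i+1}` and `s_i` exchanges `x_i` and `x_{i+1}`. The second index `j` stands
for `i + 1`. -/
def opT {n : ℕ} (i j : Fin n) (f : RatFun n) : RatFun n :=
  (-1 + tVar n) / (1 - (xVar i / xVar j)⁻¹) * f +
    (1 - tVar n * (xVar i / xVar j)) / (1 - (xVar i / xVar j)⁻¹) * xAct (Equiv.swap i j) f

/-- The family `w ↦ F w` of Laurent polynomials has the properties that determine the lifted
double motivic Chern classes `MC(X(w)°)` of the Schubert cells. -/
structure IsMotivicX {n : ℕ} (F : Perm (Fin n) → RatFun n) : Prop where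
  mem_laurent : ∀ w, F w ∈ laurent n
  base : F 1 = ∏ p : Fin n × Fin n with p.1 < p.2, (1 - xVar p.1 / yVar p.2)
  step : ∀ (w : Perm (Fin n)) (i j : Fin n), (i : ℕ) + 1 = j →
    permLength w < permLength (w * Equiv.swap i j) →
      F (w * Equiv.swap i j) = opT i j (F w)

/-- The family `w ↦ F w` of Laurent polynomials has the properties that determine the lifted
double motivic Chern classes `MC(Y(w)°)` of the opposite Schubert cells. The indices `p.1`, `p.2`
start at `0`, whence the shifts by `1` in the product over `i + j ≤ n`. -/
structure IsMotivicY {n : ℕ} (F : Perm (Fin n) → RatFun n) : Prop where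
  mem_laurent : ∀ w, F w ∈ laurent n
  base : F (longest n) =
    ∏ p : Fin n × Fin n with ((p.1 : ℕ) + 1) + ((p.2 : ℕ) + 1) ≤ n, (1 - xVar p.1 / yVar p.2)
  step : ∀ (w : Perm (Fin n)) (i j : Fin n), (i : ℕ) + 1 = j →
    permLength (w * Equiv.swap i j) < permLength w →
      F (w * Equiv.swap i j) = opT i j (F w)

end

/-! ### The lattice model

The colors are the elements of `Fin n`. A horizontal edge carries at most one color (`none` is the
label `⊕`, the absence of color), a vertical edge carries a set of colors. -/

/-- The admissible vertices, with labels `a` (left), `S` (top), `b` (right), `D` (bottom). -/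
def VertexOK {n : ℕ} : Option (Fin n) → Finset (Fin n) → Option (Fin n) → Finset (Fin n) → Prop
  | none, S, none, D => D = S
  | none, S, some c, D => c ∈ S ∧ D = S.erase c
  | some c, S, none, D => c ∉ S ∧ D = insert c S
  | some a, S, some b, D =>
      (a = b ∧ D = S) ∨ (a ≠ b ∧ a ∉ S ∧ b ∈ S ∧ D = (insert a S).erase b)

instance {n : ℕ} (a : Option (Fin n)) (S : Finset (Fin n)) (b : Option (Fin n))
    (D : Finset (Fin n)) : Decidable (VertexOK a S b D) := by
  cases a <;> cases b <;> (simp only [VertexOK]; infer_instance)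

/-- The number of colors of `S` that are greater than `c`. -/
def above {n : ℕ} (S : Finset (Fin n)) (c : Fin n) : ℕ := (S.filter fun e => c < e).card

/-- The number of colors of `S` that are smaller than `c`. -/
def below {n : ℕ} (S : Finset (Fin n)) (c : Fin n) : ℕ := (S.filter fun e => e < c).card

/-- The number of colors of `S` strictly between `c` and `d`. -/
def between {n : ℕ} (S : Finset (Fin n)) (c d : Fin n) : ℕ :=
  (S.filter fun e => c < e ∧ e < d).card

/-- The dual Boltzmann weight of an admissible vertex with row parameter `x`, column parameter
`y`, left label `a`, top label `S` and right label `b` (these determine the bottom label).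
In the second case `S` is not empty, as it contains `c`. -/
def dualWeight {K : Type*} [Field K] {n : ℕ} (t x y : K) :
    Option (Fin n) → Finset (Fin n) → Option (Fin n) → K
  | none, S, none => (-t * x) ^ S.card
  | none, S, some c => (-t) ^ below S c * t ^ above S c * x ^ (S.card - 1)
  | some c, S, none => (t - 1) * x⁻¹ * (-t) ^ above S c * x ^ (S.card + 1)
  | some a, S, some b =>
      if a = b then
        t ^ above S a * x ^ S.card * (-x⁻¹ + t ^ (if a ∈ S then 1 else 0) * y⁻¹)
      else if a < b then
        (t - 1) * x⁻¹ * (-t) ^ between S a b * t ^ above S b * x ^ S.card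
      else
        (t - 1) * y⁻¹ * (-1) ^ between S b a * t ^ above S a * x ^ S.card

/-- A labelling of the edges of the `n × n` square grid. Rows are numbered from top to bottom and
columns from right to left, both starting at `0`. The vertex in row `i` and column `j` has
top edge `vert i.castSucc j`, bottom edge `vert i.succ j`,
right edge `horiz i j.castSucc` and left edge `horiz i j.succ`. -/
structure Labelling (n : ℕ) where
  vert : Fin (n + 1) → Fin n → Finset (Fin n)
  horiz : Fin n → Fin (n + 1) → Option (Fin n)

/-- Labellings as pairs of functions. -/
def Labelling.equivProd (n : ℕ) : Labelling n ≃
    (Fin (n + 1) → Fin n → Finset (Fin n)) × (Fin n → Fin (n + 1) → Option (Fin n)) where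
  toFun s := (s.vert, s.horiz)
  invFun p := ⟨p.1, p.2⟩
  left_inv _ := rfl
  right_inv _ := rfl

instance (n : ℕ) : Fintype (Labelling n) := Fintype.ofEquiv _ (Labelling.equivProd n).symm

/-- Admissible states for the boundary conditions given by `σ` and `w` on the square: the top edge
of column `j` carries `σ j`, the right edge of row `i` carries `w i`, the left and bottom boundary
edges carry no color, and each vertex is admissible. -/
def Labelling.IsAdmissible {n : ℕ} (σ w : Perm (Fin n)) (s : Labelling n) : Prop :=
  (∀ j, s.vert 0 j = {σ j}) ∧ (∀ i, s.horiz i 0 = some (w i)) ∧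
  (∀ j, s.vert (Fin.last n) j = ∅) ∧ (∀ i, s.horiz i (Fin.last n) = none) ∧
  ∀ i j, VertexOK (s.horiz i j.succ) (s.vert i.castSucc j) (s.horiz i j.castSucc)
    (s.vert i.succ j)

instance {n : ℕ} (σ w : Perm (Fin n)) : DecidablePred (Labelling.IsAdmissible σ w) := fun s => by
  unfold Labelling.IsAdmissible; infer_instance

/-- The partition function of the square `n × n` model with boundary conditions `σ`, `w` and the
dual Boltzmann weights, at row parameters `x` and column parameters `y`. -/
def dualZ {K : Type*} [Field K] {n : ℕ} (t : K) (σ w : Perm (Fin n)) (x y : Fin n → K) : K :=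
  ∑ s : Labelling n with s.IsAdmissible σ w,
    ∏ i : Fin n, ∏ j : Fin n,
      dualWeight t (x i) (y j) (s.horiz i j.succ) (s.vert i.castSucc j) (s.horiz i j.castSucc)

end MotivicLattice

/-! The partition function is itself the required family: up to sign it obeys the same recursion and
has the same initial value as the motivic Chern classes. As it is visibly a Laurent polynomial, this
proves existence without checking braid relations for the operators `T_i`; uniqueness is an
induction on length.

The recursion is the train argument. An R-matrix acting on pairs of horizontal labels intertwines
the two-row column weights with parameters `(x₁, x₂)` and `(x₂, x₁)`
(`rMatrix_mul_twoVertexWeight`). Pushed through all columns, it acts by the scalar `1 - t x₁ / x₂`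
on the uncolored left boundary, while on the colored right boundary it mixes `w` with `w sᵢ`. The
resulting identity `dualZ_exchange`, solved for the term of `w sᵢ`, is exactly `Tᵢ`.

The Yang-Baxter equation concerns arbitrary sets of colors, but spectator colors contribute
multiplicatively (`dualWeight_eq`), by a product symmetric in the two rows. What remains depends
only on the order of the at most four colors on the horizontal edges and on which of them lie in
`S`, so it is a finite check (`yangBaxterAt`).

For `w = w₀` there is a single admissible state, whose weight is the initial value of the `Y` family
up to sign (`dualZ_longest`). The `X` family follows by the substitution `w ↦ w₀ w` together with
reversal of the column parameters. -/

namespace MotivicLattice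

/-! ### Factorization of the vertex weights over vertical colors -/

section Weights

variable {K : Type*} [Field K] {n : ℕ}

/-- The contribution of a left label to the weight of a spectator color `e`. -/
def leftFactor (t : K) : Option (Fin n) → Fin n → K
  | none, _ => -t
  | some c, e => if c < e then -t else 1

/-- The contribution of a right label to the weight of a spectator color `e`. -/
def rightFactor : Option (Fin n) → Fin n → K
  | none, _ => 1
  | some c, e => if c < e then -1 else 1

/-- The part of a vertex weight which is not multiplicative in the set of vertical colors. -/
def coreWeight (t x y : K) : Option (Fin n) → Finset (Fin n) → Option (Fin n) → K
  | none, _, none => 1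
  | none, _, some _ => -(t * x)⁻¹
  | some _, _, none => t - 1
  | some a, S, some b =>
      if a = b then -x⁻¹ + (if a ∈ S then t else 1) * y⁻¹
      else if a < b then -(t - 1) * (t * x)⁻¹ else (t - 1) * y⁻¹

/-- A vertex with left label `a`, top label `S` and right label `b` is admissible for a suitable
bottom label. -/
def Passes (a : Option (Fin n)) (S : Finset (Fin n)) (b : Option (Fin n)) : Prop :=
  a = b ∨ ((∀ c, some c = a → c ∉ S) ∧ ∀ d, some d = b → d ∈ S)

open Classical in
/-- The bottom label of an admissible vertex. -/
def outSet (a : Option (Fin n)) (S : Finset (Fin n)) (b : Option (Fin n)) : Finset (Fin n) :=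
  if a = b then S else univ.filter fun e => (e ∈ S ∨ some e = a) ∧ some e ≠ b

theorem mem_outSet {a b : Option (Fin n)} {S : Finset (Fin n)} {e : Fin n} :
    e ∈ outSet a S b ↔ (a = b ∧ e ∈ S) ∨ (a ≠ b ∧ (e ∈ S ∨ some e = a) ∧ some e ≠ b) := by
  unfold outSet
  split_ifs with h <;> simp [h]

/-- Separates admissibility into a condition on the left, top and right labels and a formula for the
bottom label, so that sums over bottom labels collapse. -/
theorem vertexOK_iff (a b : Option (Fin n)) (S D : Finset (Fin n)) :
    VertexOK a S b D ↔ Passes a S b ∧ D = outSet a S b := by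
  rcases a with _ | a <;> rcases b with _ | b
  · simp [VertexOK, Passes, outSet]
  · simp only [VertexOK, Passes]
    constructor
    · rintro ⟨h, rfl⟩
      refine ⟨Or.inr ⟨by simp, by simpa⟩, ?_⟩
      ext e; simp [mem_outSet, and_comm]
    · rintro ⟨h, rfl⟩
      refine ⟨by simpa using h, ?_⟩
      ext e; simp [mem_outSet, and_comm]
  · simp only [VertexOK, Passes]
    constructor
    · rintro ⟨h, rfl⟩
      refine ⟨Or.inr ⟨by simpa, by simp⟩, ?_⟩
      ext e; simp [mem_outSet, or_comm]
    · rintro ⟨h, rfl⟩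
      refine ⟨by simpa using h, ?_⟩
      ext e; simp [mem_outSet, or_comm]
  · by_cases hab : a = b
    · subst hab; simp [VertexOK, Passes, outSet]
    · simp only [VertexOK, Passes, Option.some.injEq, hab, false_and, false_or, not_false_eq_true,
        ne_eq, true_and, forall_eq, and_assoc]
      refine and_congr_right fun _ => and_congr_right fun _ => ?_
      have : (insert a S).erase b = outSet (some a) S (some b) := by
        ext e; simp [mem_outSet, hab, and_comm, or_comm]
      rw [this]

theorem prod_ite_lt (S : Finset (Fin n)) (c : Fin n) (A : K) :
    ∏ e ∈ S, (if c < e then A else 1) = A ^ above S c := by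
  rw [prod_ite]; simp [above]

theorem below_add_above {S : Finset (Fin n)} {c : Fin n} (h : c ∈ S) :
    below S c + above S c + 1 = S.card := by
  rw [← card_erase_add_one h,
    ← card_filter_add_card_filter_not (s := S.erase c) (fun e => e < c)]
  have h1 : (S.erase c).filter (fun e => e < c) = S.filter fun e => e < c := by
    ext e; grind
  have h2 : (S.erase c).filter (fun e => ¬ e < c) = S.filter fun e => c < e := by
    ext e; grind
  rw [h1, h2, below, above]

/-- The `+ 1` is the color `d`; its spurious factor `-t` in the product over `S` is cancelled by the
`t⁻¹` and the sign in `coreWeight`. -/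
theorem above_eq_of_mem {S : Finset (Fin n)} {c d : Fin n} (hcd : c < d) (h : d ∈ S) :
    above S c = between S c d + above S d + 1 := by
  have hd : d ∈ S.filter fun e => c < e := by simp [h, hcd]
  rw [above, ← card_erase_add_one hd,
    ← card_filter_add_card_filter_not (s := (S.filter fun e => c < e).erase d) (fun e => e < d)]
  have h1 : ((S.filter fun e => c < e).erase d).filter (fun e => e < d) =
      S.filter fun e => c < e ∧ e < d := by
    ext e; grind
  have h2 : ((S.filter fun e => c < e).erase d).filter (fun e => ¬ e < d) =
      S.filter fun e => d < e := by
    ext e; grind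
  rw [h1, h2, between, above]

theorem above_eq_of_notMem {S : Finset (Fin n)} {c d : Fin n} (hcd : c < d) (h : d ∉ S) :
    above S c = between S c d + above S d := by
  rw [above, ← card_filter_add_card_filter_not (s := S.filter fun e => c < e) (fun e => e < d)]
  have h1 : (S.filter fun e => c < e).filter (fun e => e < d) =
      S.filter fun e => c < e ∧ e < d := by
    ext e; grind
  have h2 : (S.filter fun e => c < e).filter (fun e => ¬ e < d) = S.filter fun e => d < e := by
    ext e; grind
  rw [h1, h2, between, above]

/-- Vertex weights factor into a core and a product over the vertical colors. -/
theorem dualWeight_eq {t x y : K} (ht : t ≠ 0) (hx : x ≠ 0) {a b : Option (Fin n)}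
    {S : Finset (Fin n)} (h : Passes a S b) :
    dualWeight t x y a S b =
      coreWeight t x y a S b * ∏ e ∈ S, (x * leftFactor t a e * rightFactor b e) := by
  -- Spectator colors that get a sign from both the left and the right factor get none in total;
  -- this turns `-t` into `t` for them.
  have hneg : ∀ k : ℕ, ((-1 : K) ^ k) * (-1) ^ k = 1 := fun k => by
    rw [← mul_pow]; simp
  simp only [prod_mul_distrib, prod_const]
  rcases a with _ | a <;> rcases b with _ | b
  · simp [dualWeight, coreWeight, leftFactor, rightFactor, ← mul_pow, mul_comm]
  · have hb : b ∈ S := by simpa [Passes] using h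
    have hc := below_add_above hb
    simp only [dualWeight, coreWeight, leftFactor, rightFactor, prod_const, prod_ite_lt]
    rw [← hc]
    simp only [Nat.add_sub_cancel, pow_add, pow_one, neg_pow t]
    have := hneg (above S b)
    field_simp
    linear_combination -this
  · have ha : a ∉ S := by simpa [Passes] using h
    simp only [dualWeight, coreWeight, leftFactor, rightFactor, prod_const_one, prod_ite_lt]
    rw [pow_succ]
    field_simp
  · simp only [dualWeight, coreWeight, leftFactor, rightFactor, prod_ite_lt]
    by_cases hab : a = b
    · subst hab
      have := hneg (above S a)
      simp only [if_true, neg_pow t]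
      by_cases haS : a ∈ S
      · simp only [haS, if_true, pow_one]
        linear_combination -(t ^ above S a * x ^ #S * (-x⁻¹ + t * y⁻¹)) * this
      · simp only [haS, if_false, pow_zero]
        linear_combination -(t ^ above S a * x ^ #S * (-x⁻¹ + 1 * y⁻¹)) * this
    · have hS : a ∉ S ∧ b ∈ S := by simpa [Passes, hab] using h
      simp only [hab, if_false]
      rcases lt_or_gt_of_ne hab with hlt | hlt
      · simp only [hlt, if_true]
        rw [above_eq_of_mem hlt hS.2]
        have := hneg (above S b)
        simp only [pow_add, pow_one, neg_pow t]
        field_simp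
        linear_combination -(t - 1) * this
      · simp only [hlt.not_gt, if_false]
        rw [above_eq_of_notMem hlt hS.1]
        have := hneg (above S a)
        simp only [pow_add, neg_pow t]
        linear_combination -(t - 1) * y⁻¹ * (-1) ^ between S b a * t ^ above S a * x ^ #S * this

end Weights

/-! ### The Yang-Baxter equation as a finite check -/

section YangBaxter

variable {K : Type*} [Field K] {n : ℕ}

/-- The diagonal part of the R-matrix. -/
def rDiag (t x₁ x₂ : K) : Option (Fin n) → Option (Fin n) → K
  | none, none => 1 - t * (x₁ / x₂)
  | none, some _ => 1 - t
  | some _, none => 1 - t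
  | some a, some b =>
      if a = b then 1 - t * (x₂ / x₁) else if b < a then 1 - t else (1 - t) * (x₂ / x₁)

/-- The part of the R-matrix that exchanges labels. -/
def rSwap (t x₁ x₂ : K) : Option (Fin n) → Option (Fin n) → K
  | none, none => 0
  | none, some _ => t * (x₁ - x₂)
  | some _, none => x₂⁻¹ - x₁⁻¹
  | some a, some b =>
      if a = b then 0 else if b < a then 1 - x₂ / x₁ else t * (1 - x₂ / x₁)

/-- The factor by which the color `a` changes the product over the vertical colors in the second
row. -/
def transferFactor (t x : K) (a' b' : Option (Fin n)) : Option (Fin n) → K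
  | none => 1
  | some e => x * leftFactor t a' e * rightFactor b' e

open Classical in
/-- The weight of two vertices above each other, without the product over all vertical colors. -/
noncomputable def coreTwo (t x₁ x₂ y : K) (S : Finset (Fin n)) (a a' b b' : Option (Fin n)) : K :=
  if Passes a S b ∧ Passes a' (outSet a S b) b' then
    coreWeight t x₁ y a S b * coreWeight t x₂ y a' (outSet a S b) b' *
      (transferFactor t x₂ a' b' a / transferFactor t x₂ a' b' b)
  else 0

/-- The Yang-Baxter equation, without the product over all vertical colors. -/
def YangBaxterAt (t x₁ x₂ y : K) (S : Finset (Fin n)) (a a' b b' : Option (Fin n)) : Prop :=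
  rDiag t x₁ x₂ b b' * coreTwo t x₁ x₂ y S a a' b b' +
      rSwap t x₁ x₂ b b' * coreTwo t x₁ x₂ y S a a' b' b =
    rDiag t x₁ x₂ a a' * coreTwo t x₂ x₁ y S a a' b b' +
      rSwap t x₁ x₂ a' a * coreTwo t x₂ x₁ y S a' a b b'

theorem passes_none_none {S : Finset (Fin n)} : Passes none S none ↔ True := by
  simp [Passes]

theorem passes_none_some {S : Finset (Fin n)} {b : Fin n} : Passes none S (some b) ↔ b ∈ S := by
  simp [Passes]

theorem passes_some_none {S : Finset (Fin n)} {a : Fin n} : Passes (some a) S none ↔ a ∉ S := by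
  simp [Passes]

theorem passes_some_some {S : Finset (Fin n)} {a b : Fin n} :
    Passes (some a) S (some b) ↔ a = b ∨ (a ∉ S ∧ b ∈ S) := by
  simp [Passes]

theorem yangBaxterAt_of_one {t x₁ x₂ y : K} (ht : t ≠ 0) (h₁ : x₁ ≠ 0) (h₂ : x₂ ≠ 0)
    (hy : y ≠ 0) (S : Finset (Fin n)) (p : Fin n) (a a' b b' : Option (Fin n))
    (ha : a = none ∨ a = some p) (ha' : a' = none ∨ a' = some p)
    (hb : b = none ∨ b = some p) (hb' : b' = none ∨ b' = some p) :
    YangBaxterAt t x₁ x₂ y S a a' b b' := by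
  by_cases hp : p ∈ S <;>
  rcases ha with rfl | rfl <;> rcases ha' with rfl | rfl <;>
  rcases hb with rfl | rfl <;> rcases hb' with rfl | rfl <;>
  simp only [YangBaxterAt, coreTwo, passes_none_none, passes_none_some, passes_some_none,
    passes_some_some, mem_outSet, hp, reduceCtorEq, and_true, and_false, or_true, or_false,
    if_true, if_false, not_true, not_false_iff, ne_eq, mul_zero, add_zero, rDiag, rSwap,
    coreWeight, leftFactor, rightFactor, transferFactor, zero_add, zero_mul, lt_irrefl] <;>
  (try (field_simp <;> try ring))

set_option maxHeartbeats 4000000 in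
theorem yangBaxterAt_of_lt {t x₁ x₂ y : K} (ht : t ≠ 0) (h₁ : x₁ ≠ 0) (h₂ : x₂ ≠ 0)
    (hy : y ≠ 0) (S : Finset (Fin n)) {p q : Fin n} (hpq : p < q) (a a' b b' : Option (Fin n))
    (ha : a = none ∨ a = some p ∨ a = some q) (ha' : a' = none ∨ a' = some p ∨ a' = some q)
    (hb : b = none ∨ b = some p ∨ b = some q) (hb' : b' = none ∨ b' = some p ∨ b' = some q) :
    YangBaxterAt t x₁ x₂ y S a a' b b' := by
  by_cases hp : p ∈ S <;> by_cases hq : q ∈ S <;>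
  rcases ha with rfl | rfl | rfl <;> rcases ha' with rfl | rfl | rfl <;>
  rcases hb with rfl | rfl | rfl <;> rcases hb' with rfl | rfl | rfl <;>
  simp only [YangBaxterAt, coreTwo, passes_none_none, passes_none_some, passes_some_none,
    passes_some_some, mem_outSet, hp, hq, hpq.ne, hpq.ne', hpq, hpq.not_gt,
    Option.some.injEq, reduceCtorEq, and_true, and_false, or_true, or_false, if_true,
    if_false, not_true, not_false_iff, ne_eq, mul_zero, add_zero, rDiag, rSwap, coreWeight,
    leftFactor, rightFactor, transferFactor, zero_add, zero_mul, lt_irrefl] <;>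
  (try (field_simp <;> try ring))

-- With exactly three distinct colors on four edges, either one edge is uncolored (four patterns) or
-- one color occurs twice (six patterns). The three colors are not ordered in advance, so each
-- pattern also splits by order.
set_option maxHeartbeats 4000000 in
theorem yangBaxterAt_of_three {t x₁ x₂ y : K} (ht : t ≠ 0) (h₁ : x₁ ≠ 0) (h₂ : x₂ ≠ 0)
    (hy : y ≠ 0) (S : Finset (Fin n)) {p q r : Fin n} (hpq : p ≠ q) (hpr : p ≠ r) (hqr : q ≠ r)
    (a a' b b' : Option (Fin n))
    (h : (a, a', b, b') = (none, some p, some q, some r) ∨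
      (a, a', b, b') = (some p, none, some q, some r) ∨
      (a, a', b, b') = (some p, some q, none, some r) ∨
      (a, a', b, b') = (some p, some q, some r, none) ∨
      (a, a', b, b') = (some p, some p, some q, some r) ∨
      (a, a', b, b') = (some p, some q, some r, some r) ∨
      (a, a', b, b') = (some p, some q, some p, some r) ∨
      (a, a', b, b') = (some p, some q, some r, some p) ∨
      (a, a', b, b') = (some q, some p, some p, some r) ∨
      (a, a', b, b') = (some q, some p, some r, some p)) :
    YangBaxterAt t x₁ x₂ y S a a' b b' := by
  simp only [Prod.mk.injEq] at h
  by_cases hp : p ∈ S <;> by_cases hq : q ∈ S <;> by_cases hr : r ∈ S <;>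
  obtain ⟨rfl, rfl, rfl, rfl⟩ | ⟨rfl, rfl, rfl, rfl⟩ | ⟨rfl, rfl, rfl, rfl⟩ | ⟨rfl, rfl, rfl, rfl⟩ |
    ⟨rfl, rfl, rfl, rfl⟩ | ⟨rfl, rfl, rfl, rfl⟩ | ⟨rfl, rfl, rfl, rfl⟩ | ⟨rfl, rfl, rfl, rfl⟩ |
    ⟨rfl, rfl, rfl, rfl⟩ | ⟨rfl, rfl, rfl, rfl⟩ := h <;>
  simp only [YangBaxterAt, coreTwo, passes_none_some, passes_some_none, passes_some_some,
    mem_outSet, hp, hq, hr, hpq, hpq.symm, hpr, hpr.symm, hqr, hqr.symm, Option.some.injEq,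
    reduceCtorEq, and_true, and_false, or_true, or_false, if_true, if_false, not_true,
    not_false_iff, ne_eq, mul_zero, add_zero, rDiag, rSwap, coreWeight, leftFactor,
    rightFactor, transferFactor, zero_add, lt_irrefl] <;>
  rcases hpq.lt_or_gt with hpq | hpq <;> simp only [hpq, hpq.not_gt, if_true, if_false] <;>
  rcases hpr.lt_or_gt with hpr | hpr <;>
  simp only [hpr, hpr.not_gt, if_true, if_false] <;>
  rcases hqr.lt_or_gt with hqr | hqr <;> (try (exfalso; order)) <;>
  simp only [hqr, hqr.not_gt, if_true, if_false] <;>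
  (field_simp <;> try ring)

theorem yangBaxterAt_of_distinct {t x₁ x₂ y : K} (ht : t ≠ 0) (h₁ : x₁ ≠ 0) (h₂ : x₂ ≠ 0)
    (hy : y ≠ 0) (S : Finset (Fin n)) {a a' b b' : Fin n} (haa : a ≠ a') (hbb : b ≠ b')
    (hab : a ≠ b) (hab' : a ≠ b') (ha'b : a' ≠ b) (ha'b' : a' ≠ b') :
    YangBaxterAt t x₁ x₂ y S (some a) (some a') (some b) (some b') := by
  by_cases h : (a ∉ S ∧ a' ∉ S) ∧ b ∈ S ∧ b' ∈ S
  · simp only [YangBaxterAt, coreTwo, Passes, coreWeight, transferFactor, mem_outSet, h,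
      Option.some.injEq, haa, haa.symm, hbb, hbb.symm, hab, hab.symm, hab', hab'.symm, ha'b,
      ha'b', ha'b'.symm, forall_eq, ne_eq, not_false_iff, or_false, false_or, and_true,
      true_and, if_true, false_and, or_true, rDiag, rSwap, leftFactor, rightFactor, if_false]
    rcases haa.lt_or_gt with haa | haa <;> rcases hbb.lt_or_gt with hbb | hbb <;>
    simp only [haa, hbb, haa.not_gt, hbb.not_gt, if_true, if_false] <;>
    rcases hab.lt_or_gt with hab | hab <;> simp only [hab, hab.not_gt, if_true, if_false] <;>
    rcases hab'.lt_or_gt with hab' | hab' <;> (try (exfalso; order)) <;>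
    simp only [hab', hab'.not_gt, if_true, if_false] <;>
    rcases ha'b.lt_or_gt with ha'b | ha'b <;> (try (exfalso; order)) <;>
    simp only [ha'b, ha'b.not_gt, if_true, if_false] <;>
    rcases ha'b'.lt_or_gt with ha'b' | ha'b' <;> (try (exfalso; order)) <;>
    simp only [ha'b', ha'b'.not_gt, if_true, if_false] <;>
    field_simp <;> ring
  -- Four distinct colors force both left colors to be absorbed and both right colors to be emitted,
  -- so otherwise all four terms vanish.
  · have hP : ∀ c c' d d' : Fin n, (c = a ∧ c' = a' ∨ c = a' ∧ c' = a) →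
        (d = b ∧ d' = b' ∨ d = b' ∧ d' = b) → ¬ (Passes (some c) S (some d) ∧
          Passes (some c') (outSet (some c) S (some d)) (some d')) := by
      rintro c c' d d' (⟨rfl, rfl⟩ | ⟨rfl, rfl⟩) (⟨rfl, rfl⟩ | ⟨rfl, rfl⟩) <;>
      · simp [Passes, mem_outSet, *, Ne.symm]
        grind
    simp [YangBaxterAt, coreTwo, hP]

theorem yangBaxterAt_of_two {t x₁ x₂ y : K} (ht : t ≠ 0) (h₁ : x₁ ≠ 0) (h₂ : x₂ ≠ 0)
    (hy : y ≠ 0) (S : Finset (Fin n)) (p q : Fin n) (a a' b b' : Option (Fin n))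
    (ha : a = none ∨ a = some p ∨ a = some q) (ha' : a' = none ∨ a' = some p ∨ a' = some q)
    (hb : b = none ∨ b = some p ∨ b = some q) (hb' : b' = none ∨ b' = some p ∨ b' = some q) :
    YangBaxterAt t x₁ x₂ y S a a' b b' := by
  rcases lt_trichotomy p q with h | rfl | h
  · exact yangBaxterAt_of_lt ht h₁ h₂ hy S h a a' b b' ha ha' hb hb'
  · simp only [or_self] at ha ha' hb hb'
    exact yangBaxterAt_of_one ht h₁ h₂ hy S p a a' b b' ha ha' hb hb'
  · rw [or_comm (a := _ = some p)] at ha ha' hb hb'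
    exact yangBaxterAt_of_lt ht h₁ h₂ hy S h a a' b b' ha ha' hb hb'

/-- The Yang-Baxter equation, without the product over all vertical colors. -/
theorem yangBaxterAt {t x₁ x₂ y : K} (ht : t ≠ 0) (h₁ : x₁ ≠ 0) (h₂ : x₂ ≠ 0)
    (hy : y ≠ 0) (S : Finset (Fin n)) (a a' b b' : Option (Fin n)) :
    YangBaxterAt t x₁ x₂ y S a a' b b' := by
  have two := fun p q => yangBaxterAt_of_two ht h₁ h₂ hy S p q
  have three := fun {p q r} => yangBaxterAt_of_three ht h₁ h₂ hy S (p := p) (q := q) (r := r)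
  have h3 : ∀ p q r : Fin n, p = q ∨ p = r ∨ q = r ∨ (p ≠ q ∧ p ≠ r ∧ q ≠ r) := by intros; tauto
  rcases a with _ | a <;> rcases a' with _ | a' <;> rcases b with _ | b <;> rcases b' with _ | b'
  · simp [YangBaxterAt, coreTwo, Passes, coreWeight, transferFactor, rDiag, rSwap]
  · exact two b' b' _ _ _ _ (by simp) (by simp) (by simp) (by simp)
  · exact two b b _ _ _ _ (by simp) (by simp) (by simp) (by simp)
  · exact two b b' _ _ _ _ (by simp) (by simp) (by simp) (by simp)
  · exact two a' a' _ _ _ _ (by simp) (by simp) (by simp) (by simp)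
  · exact two a' b' _ _ _ _ (by simp) (by simp) (by simp) (by simp)
  · exact two a' b _ _ _ _ (by simp) (by simp) (by simp) (by simp)
  · rcases h3 a' b b' with rfl | rfl | rfl | ⟨h, h', h''⟩
    · exact two a' b' _ _ _ _ (by simp) (by simp) (by simp) (by simp)
    · exact two a' b _ _ _ _ (by simp) (by simp) (by simp) (by simp)
    · exact two a' b _ _ _ _ (by simp) (by simp) (by simp) (by simp)
    · exact three h h' h'' _ _ _ _ (by simp)
  · exact two a a _ _ _ _ (by simp) (by simp) (by simp) (by simp)
  · exact two a b' _ _ _ _ (by simp) (by simp) (by simp) (by simp)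
  · exact two a b _ _ _ _ (by simp) (by simp) (by simp) (by simp)
  · rcases h3 a b b' with rfl | rfl | rfl | ⟨h, h', h''⟩
    · exact two a b' _ _ _ _ (by simp) (by simp) (by simp) (by simp)
    · exact two a b _ _ _ _ (by simp) (by simp) (by simp) (by simp)
    · exact two a b _ _ _ _ (by simp) (by simp) (by simp) (by simp)
    · exact three h h' h'' _ _ _ _ (by simp)
  · exact two a a' _ _ _ _ (by simp) (by simp) (by simp) (by simp)
  · rcases h3 a a' b' with rfl | rfl | rfl | ⟨h, h', h''⟩
    · exact two a b' _ _ _ _ (by simp) (by simp) (by simp) (by simp)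
    · exact two a a' _ _ _ _ (by simp) (by simp) (by simp) (by simp)
    · exact two a a' _ _ _ _ (by simp) (by simp) (by simp) (by simp)
    · exact three h h' h'' _ _ _ _ (by simp)
  · rcases h3 a a' b with rfl | rfl | rfl | ⟨h, h', h''⟩
    · exact two a b _ _ _ _ (by simp) (by simp) (by simp) (by simp)
    · exact two a a' _ _ _ _ (by simp) (by simp) (by simp) (by simp)
    · exact two a a' _ _ _ _ (by simp) (by simp) (by simp) (by simp)
    · exact three h h' h'' _ _ _ _ (by simp)
  · rcases eq_or_ne a a' with rfl | haa
    · rcases h3 a b b' with rfl | rfl | rfl | ⟨h, h', h''⟩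
      · exact two a b' _ _ _ _ (by simp) (by simp) (by simp) (by simp)
      · exact two a b _ _ _ _ (by simp) (by simp) (by simp) (by simp)
      · exact two a b _ _ _ _ (by simp) (by simp) (by simp) (by simp)
      · exact three h h' h'' _ _ _ _ (by simp)
    · rcases h3 a b b' with rfl | rfl | rfl | ⟨hab, hab', hbb⟩
      · rcases h3 a a' b' with h | rfl | rfl | ⟨h, h', h''⟩
        · exact absurd h haa
        · exact two a a' _ _ _ _ (by simp) (by simp) (by simp) (by simp)
        · exact two a a' _ _ _ _ (by simp) (by simp) (by simp) (by simp)
        · exact three h h' h'' _ _ _ _ (by simp)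
      · rcases h3 a a' b with h | rfl | rfl | ⟨h, h', h''⟩
        · exact absurd h haa
        · exact two a a' _ _ _ _ (by simp) (by simp) (by simp) (by simp)
        · exact two a a' _ _ _ _ (by simp) (by simp) (by simp) (by simp)
        · exact three h h' h'' _ _ _ _ (by simp)
      · rcases h3 a a' b with h | rfl | rfl | ⟨h, h', h''⟩
        · exact absurd h haa
        · exact two a a' _ _ _ _ (by simp) (by simp) (by simp) (by simp)
        · exact two a a' _ _ _ _ (by simp) (by simp) (by simp) (by simp)
        · exact three h h' h'' _ _ _ _ (by simp)
      · rcases h3 a' b b' with rfl | rfl | h | ⟨h, h', -⟩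
        · exact three haa.symm hbb hab' _ _ _ _ (by simp)
        · exact three haa.symm hbb.symm hab _ _ _ _ (by simp)
        · exact absurd h hbb
        · exact yangBaxterAt_of_distinct ht h₁ h₂ hy S haa hbb hab hab' h h'

end YangBaxter

/-! ### From the core identity to the full Yang-Baxter equation -/

section TwoRows

variable {K : Type*} [Field K] {n : ℕ}

open Classical in
/-- The number of times the color `e` occurs on an edge with label `a` and on one with label `S`. -/
noncomputable def occ (a : Option (Fin n)) (S : Finset (Fin n)) (e : Fin n) : ℕ :=
  (if e ∈ S then 1 else 0) + (if some e = a then 1 else 0)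

/-- Conservation of each color determines the bottom label. In this form the condition is additive,
so for two rows the intermediate label drops out. -/
theorem eq_outSet_iff {a b : Option (Fin n)} {S D : Finset (Fin n)} (h : Passes a S b) :
    D = outSet a S b ↔ ∀ e, occ a S e = occ b D e := by
  have hS : ∀ e, occ a S e = occ b (outSet a S b) e := by
    intro e
    rcases h with rfl | ⟨h1, h2⟩
    · simp [occ, mem_outSet]
    · have h1 := h1 e
      have h2 := h2 e
      by_cases hab : a = b
      · simp [occ, mem_outSet, hab]
      · simp only [occ, mem_outSet, hab]
        grind
  constructor
  · rintro rfl; exact hS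
  · intro hD
    ext e
    have h1 := hD e
    rw [hS e] at h1
    unfold occ at h1
    by_cases hx : e ∈ D <;> by_cases hy : e ∈ outSet a S b <;> simp_all

/-- A factor for each color, extended by `1` to the label without color. -/
def optFactor (f : Fin n → K) : Option (Fin n) → K
  | none => 1
  | some e => f e

/-- Passing through a vertex adds the color `a` and removes `b`. This moves the spectator product of
the second row back to the top set `S`, at the cost of the quotient in `coreTwo`. -/
theorem prod_outSet {a b : Option (Fin n)} {S : Finset (Fin n)} (h : Passes a S b)
    (f : Fin n → K) :
    (∏ e ∈ outSet a S b, f e) * optFactor f b = (∏ e ∈ S, f e) * optFactor f a := by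
  by_cases hab : a = b
  · subst hab; simp [outSet]
  · rcases h with h | ⟨h1, h2⟩
    · exact absurd h hab
    rcases a with _ | a <;> rcases b with _ | b
    · exact absurd rfl hab
    · have hb := h2 b rfl
      have : outSet none S (some b) = S.erase b := by ext e; simp [mem_outSet, and_comm]
      rw [this]; simp [optFactor, prod_erase_mul _ _ hb]
    · have ha := h1 a rfl
      have : outSet (some a) S none = insert a S := by ext e; simp [mem_outSet, or_comm]
      rw [this]; simp [optFactor, prod_insert ha, mul_comm]
    · have hb := h2 b rfl
      have ha := h1 a rfl
      have : outSet (some a) S (some b) = insert a (S.erase b) := by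
        ext e
        have : a ≠ b := fun h => hab (by rw [h])
        simp only [mem_outSet, mem_insert, mem_erase]
        grind
      rw [this, prod_insert (by simp [ha]), ← prod_erase_mul S f hb]
      simp only [optFactor]
      ring

/-- The weight of a vertex with labels `a`, `S`, `b`, `D`, zero unless the vertex is admissible. -/
def vertexWeight (t x y : K) (a : Option (Fin n)) (S : Finset (Fin n)) (b : Option (Fin n))
    (D : Finset (Fin n)) : K :=
  if VertexOK a S b D then dualWeight t x y a S b else 0

/-- The weight of two vertices above each other, as a matrix indexed by the pairs of right labels
and of left labels. -/
def twoVertexWeight (t x₁ x₂ y : K) (S S'' : Finset (Fin n)) :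
    Matrix (Option (Fin n) × Option (Fin n)) (Option (Fin n) × Option (Fin n)) K :=
  fun p q => ∑ S', vertexWeight t x₁ y q.1 S p.1 S' * vertexWeight t x₂ y q.2 S' p.2 S''

open Classical in
theorem vertexWeight_eq {t x y : K} (ht : t ≠ 0) (hx : x ≠ 0) (a b : Option (Fin n))
    (S D : Finset (Fin n)) :
    vertexWeight t x y a S b D = if Passes a S b ∧ D = outSet a S b then
      coreWeight t x y a S b * ∏ e ∈ S, (x * leftFactor t a e * rightFactor b e) else 0 := by
  unfold vertexWeight
  simp only [vertexOK_iff]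
  split_ifs with h
  · rw [dualWeight_eq ht hx h.1]
  · rfl

theorem transferFactor_eq (t x : K) (a' b' : Option (Fin n)) :
    transferFactor t x a' b' = optFactor fun e => x * leftFactor t a' e * rightFactor b' e := by
  funext a; cases a <;> rfl

theorem transferFactor_ne_zero {t x : K} (ht : t ≠ 0) (hx : x ≠ 0) (a' b' c : Option (Fin n)) :
    transferFactor t x a' b' c ≠ 0 := by
  rcases c with _ | c
  · exact one_ne_zero
  · rcases a' with _ | a' <;> rcases b' with _ | b' <;>
      simp only [transferFactor, leftFactor, rightFactor] <;> (try split_ifs) <;> simp [ht, hx]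

-- The intermediate label is forced to be `outSet a S b`. The first factor is then invariant under
-- exchanging the two rows' left labels, right labels or parameters, so it is common to all terms of
-- the Yang-Baxter equation.
open Classical in
theorem twoVertexWeight_eq {t x₁ x₂ y : K} (ht : t ≠ 0) (h₁ : x₁ ≠ 0) (h₂ : x₂ ≠ 0)
    (S S'' : Finset (Fin n)) (a a' b b' : Option (Fin n)) :
    twoVertexWeight t x₁ x₂ y S S'' (b, b') (a, a') =
      (if ∀ e, occ a S e + (if some e = a' then 1 else 0) =
          occ b S'' e + (if some e = b' then 1 else 0) then
        ∏ e ∈ S, ((x₁ * leftFactor t a e * rightFactor b e) *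
          (x₂ * leftFactor t a' e * rightFactor b' e)) else 0) *
      coreTwo t x₁ x₂ y S a a' b b' := by
  simp only [twoVertexWeight, vertexWeight_eq ht h₁, vertexWeight_eq ht h₂]
  rw [Finset.sum_eq_single (outSet a S b)]
  · unfold coreTwo
    by_cases h1 : Passes a S b
    · by_cases h2 : Passes a' (outSet a S b) b'
      · have hcons : S'' = outSet a' (outSet a S b) b' ↔
            ∀ e, occ a S e + (if some e = a' then 1 else 0) =
              occ b S'' e + (if some e = b' then 1 else 0) := by
          rw [eq_outSet_iff h2]
          refine forall_congr' fun e => ?_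
          have := (eq_outSet_iff h1).1 rfl e
          unfold occ at this ⊢
          omega
        simp only [h1, h2, true_and, if_true, and_self, ← hcons]
        split_ifs with h
        · rw [prod_mul_distrib (f := fun e => x₁ * leftFactor t a e * rightFactor b e)
            (g := fun e => x₂ * leftFactor t a' e * rightFactor b' e), transferFactor_eq]
          have hne : optFactor (fun e => x₂ * leftFactor t a' e * rightFactor b' e) b ≠ 0 := by
            rw [← transferFactor_eq]; exact transferFactor_ne_zero ht h₂ _ _ _
          have hp := prod_outSet h1 fun e => x₂ * leftFactor t a' e * rightFactor b' e
          rw [← eq_div_iff hne] at hp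
          rw [hp]; ring
        · simp
      · simp [h2]
    · simp [h1]
  · intro D _ hD
    simp [hD]
  · simp

/-- The R-matrix, indexed by pairs of horizontal labels. -/
def rMatrix (n : ℕ) (t x₁ x₂ : K) :
    Matrix (Option (Fin n) × Option (Fin n)) (Option (Fin n) × Option (Fin n)) K :=
  fun p q => (if q = p then rDiag t x₁ x₂ p.1 p.2 else 0) +
    (if q = p.swap then rSwap t x₁ x₂ p.1 p.2 else 0)

theorem rMatrix_mul_apply (t x₁ x₂ : K)
    (M : Matrix (Option (Fin n) × Option (Fin n)) (Option (Fin n) × Option (Fin n)) K)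
    (p q : Option (Fin n) × Option (Fin n)) :
    (rMatrix n t x₁ x₂ * M) p q =
      rDiag t x₁ x₂ p.1 p.2 * M p q + rSwap t x₁ x₂ p.1 p.2 * M p.swap q := by
  simp [Matrix.mul_apply, rMatrix, add_mul, sum_add_distrib, ite_mul]

theorem mul_rMatrix_apply (t x₁ x₂ : K)
    (M : Matrix (Option (Fin n) × Option (Fin n)) (Option (Fin n) × Option (Fin n)) K)
    (p q : Option (Fin n) × Option (Fin n)) :
    (M * rMatrix n t x₁ x₂) p q =
      rDiag t x₁ x₂ q.1 q.2 * M p q + rSwap t x₁ x₂ q.2 q.1 * M p q.swap := by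
  have h : ∀ c : Option (Fin n) × Option (Fin n), q = c.swap ↔ q.swap = c := fun c =>
    ⟨fun h => by simp [h], fun h => by simp [← h]⟩
  simp [Matrix.mul_apply, rMatrix, mul_add, sum_add_distrib, mul_ite, h, mul_comm]

/-- The Yang-Baxter equation. -/
theorem rMatrix_mul_twoVertexWeight {t x₁ x₂ y : K} (ht : t ≠ 0) (h₁ : x₁ ≠ 0) (h₂ : x₂ ≠ 0)
    (hy : y ≠ 0) (S S'' : Finset (Fin n)) :
    rMatrix n t x₁ x₂ * twoVertexWeight t x₁ x₂ y S S'' =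
      twoVertexWeight t x₂ x₁ y S S'' * rMatrix n t x₁ x₂ := by
  classical
  ext ⟨b, b'⟩ ⟨a, a'⟩
  rw [rMatrix_mul_apply, mul_rMatrix_apply]
  simp only [Prod.swap_prod_mk, twoVertexWeight_eq ht h₁ h₂, twoVertexWeight_eq ht h₂ h₁]
  have key := yangBaxterAt ht h₁ h₂ hy S a a' b b'
  unfold YangBaxterAt at key
  have hcons : ∀ c c' d d' : Option (Fin n), (c = a ∧ c' = a' ∨ c = a' ∧ c' = a) →
      (d = b ∧ d' = b' ∨ d = b' ∧ d' = b) →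
      ((∀ e, occ c S e + (if some e = c' then 1 else 0) =
          occ d S'' e + (if some e = d' then 1 else 0)) ↔
        ∀ e, occ a S e + (if some e = a' then 1 else 0) =
          occ b S'' e + (if some e = b' then 1 else 0)) := by
    intro c c' d d' hc hd
    refine forall_congr' fun e => ?_
    unfold occ
    rcases hc with ⟨rfl, rfl⟩ | ⟨rfl, rfl⟩ <;> rcases hd with ⟨rfl, rfl⟩ | ⟨rfl, rfl⟩ <;> omega
  simp only [hcons a a' b' b (by simp) (by simp), hcons a' a b b' (by simp) (by simp)]
  split_ifs with h
  · have hp : ∀ c c' d d' : Option (Fin n), ∀ u v : K, (c = a ∧ c' = a' ∨ c = a' ∧ c' = a) →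
        (d = b ∧ d' = b' ∨ d = b' ∧ d' = b) → (u = x₁ ∧ v = x₂ ∨ u = x₂ ∧ v = x₁) →
        ∏ e ∈ S, ((u * leftFactor t c e * rightFactor d e) *
          (v * leftFactor t c' e * rightFactor d' e)) =
        ∏ e ∈ S, ((x₁ * leftFactor t a e * rightFactor b e) *
          (x₂ * leftFactor t a' e * rightFactor b' e)) := by
      intro c c' d d' u v hc hd hu
      refine prod_congr rfl fun e _ => ?_
      rcases hc with ⟨rfl, rfl⟩ | ⟨rfl, rfl⟩ <;> rcases hd with ⟨rfl, rfl⟩ | ⟨rfl, rfl⟩ <;>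
        rcases hu with ⟨rfl, rfl⟩ | ⟨rfl, rfl⟩ <;> ring
    rw [hp a a' b' b x₁ x₂ (by simp) (by simp) (by simp),
      hp a a' b b' x₂ x₁ (by simp) (by simp) (by simp),
      hp a' a b b' x₂ x₁ (by simp) (by simp) (by simp)]
    linear_combination (∏ e ∈ S, ((x₁ * leftFactor t a e * rightFactor b e) *
          (x₂ * leftFactor t a' e * rightFactor b' e))) * key
  · simp

end TwoRows

/-! ### Ordered products of matrices -/

section NoncommutativeProducts

/-- Distributivity for ordered products. -/
theorem sum_prod_ofFn {R α : Type*} [Semiring R] [Fintype α] :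
    ∀ {m : ℕ} (F : Fin m → α → R),
      ∑ v : Fin m → α, (List.ofFn fun j => F j (v j)).prod = (List.ofFn fun j => ∑ a, F j a).prod
  | 0, F => by simp
  | m + 1, F => by
    rw [← (Fin.consEquiv fun _ => α).sum_comp, Fintype.sum_prod_type]
    simp only [List.ofFn_succ, List.prod_cons, Fin.consEquiv_apply, Fin.cons_zero, Fin.cons_succ,
      ← mul_sum]
    rw [sum_prod_ofFn fun j => F j.succ, sum_mul]

/-- The train argument in abstract form: `r` moves past one factor at a time. -/
theorem mul_prod_ofFn {M : Type*} [Monoid M] (r : M) :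
    ∀ {m : ℕ} {A B : Fin m → M}, (∀ j, r * A j = B j * r) →
      r * (List.ofFn A).prod = (List.ofFn B).prod * r
  | 0, A, B, _ => by simp
  | m + 1, A, B, h => by
    rw [List.ofFn_succ, List.ofFn_succ, List.prod_cons, List.prod_cons, ← mul_assoc, h 0,
      mul_assoc, mul_prod_ofFn r fun j => h j.succ, mul_assoc]

/-- Matrix products as sums over paths, with the endpoints prescribed; the paths will be sequences
of edge labels. -/
theorem prod_ofFn_apply {R ι : Type*} [CommSemiring R] [Fintype ι] [DecidableEq ι] :
    ∀ {m : ℕ} (A : Fin m → Matrix ι ι R) (u v : ι), (List.ofFn A).prod u v =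
      ∑ p : Fin (m + 1) → ι, if p 0 = u ∧ p (Fin.last m) = v then
        ∏ j : Fin m, A j (p j.castSucc) (p j.succ) else 0
  | 0, A, u, v => by
    rw [← (Fin.consEquiv fun _ => ι).sum_comp, Fintype.sum_prod_type]
    simp [Matrix.one_apply, ite_and]
  | m + 1, A, u, v => by
    rw [List.ofFn_succ, List.prod_cons, Matrix.mul_apply,
      ← (Fin.consEquiv fun _ => ι).sum_comp, Fintype.sum_prod_type]
    simp only [Fin.consEquiv_apply, Fin.cons_zero, ite_and, ← Fin.succ_last, Fin.cons_succ]
    rw [Finset.sum_comm]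
    simp only [sum_ite_eq', mem_univ, if_true]
    simp only [prod_ofFn_apply (fun j => A j.succ), mul_sum, mul_ite, mul_zero]
    rw [Finset.sum_comm]
    refine sum_congr rfl fun p _ => ?_
    simp [ite_and, Fin.prod_univ_succ, Fin.castSucc_succ]

open scoped Kronecker in
theorem prod_ofFn_kronecker {R ι κ : Type*} [CommSemiring R] [Fintype ι] [DecidableEq ι]
    [Fintype κ] [DecidableEq κ] :
    ∀ {m : ℕ} (A : Fin m → Matrix ι ι R) (B : Fin m → Matrix κ κ R),
      (List.ofFn A).prod ⊗ₖ (List.ofFn B).prod = (List.ofFn fun j => A j ⊗ₖ B j).prod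
  | 0, A, B => by simp
  | m + 1, A, B => by
    rw [List.ofFn_succ, List.ofFn_succ, List.ofFn_succ, List.prod_cons, List.prod_cons,
      List.prod_cons, Matrix.mul_kronecker_mul, prod_ofFn_kronecker]

/-- An ordered product, as a function of two adjacent factors. -/
theorem exists_prod_ofFn_eq {M : Type*} [Monoid M] {n : ℕ} (A : Fin n → M) {i j : Fin n}
    (hij : (i : ℕ) + 1 = j) :
    ∃ l r : M, ∀ B : Fin n → M, (∀ k, k ≠ i → k ≠ j → B k = A k) →
      (List.ofFn B).prod = l * (B i * B j) * r := by
  refine ⟨((List.ofFn A).take i).prod, ((List.ofFn A).drop (j + 1)).prod, fun B hB => ?_⟩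
  have h1 : (List.ofFn A).take i = (List.ofFn B).take i := by
    refine List.ext_getElem (by simp) fun k hk _ => ?_
    simp only [List.getElem_take, List.getElem_ofFn]
    simp at hk
    exact (hB _ (by simp [Fin.ext_iff]; omega) (by simp [Fin.ext_iff]; omega)).symm
  have h2 : (List.ofFn A).drop (j + 1) = (List.ofFn B).drop (j + 1) := by
    refine List.ext_getElem (by simp) fun k hk _ => ?_
    simp only [List.getElem_drop, List.getElem_ofFn]
    exact (hB _ (by simp [Fin.ext_iff]; omega) (by simp [Fin.ext_iff]; omega)).symm
  rw [h1, h2, ← List.prod_take_mul_prod_drop (List.ofFn B) i, mul_assoc]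
  congr 1
  rw [List.drop_eq_getElem_cons (by simp), List.prod_cons, hij,
    List.drop_eq_getElem_cons (by simp), List.prod_cons, mul_assoc]
  simp

end NoncommutativeProducts

/-! ### Row transfer matrices and the exchange relation -/

section TransferMatrices

variable {K : Type*} [Field K] {n : ℕ}

/-- The weights of the row with right label `r`, as a matrix indexed by the labels of the vertical
edges above and below the row. -/
def rowMatrix (t x : K) (y : Fin n → K) (r : Fin n) :
    Matrix (Fin n → Finset (Fin n)) (Fin n → Finset (Fin n)) K :=
  fun T B => (List.ofFn fun j => Matrix.of fun b a =>
    vertexWeight t x (y j) a (T j) b (B j)).prod (some r) none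

/-- The outer path sum runs over vertical labels from top to bottom, the inner ones over horizontal
labels from right to left. The boundary conditions select the matrix entries. -/
theorem dualZ_eq_prod (t : K) (σ w : Perm (Fin n)) (x y : Fin n → K) :
    dualZ t σ w x y =
      (List.ofFn fun i => rowMatrix t (x i) y (w i)).prod (fun j => {σ j}) fun _ => ∅ := by
  rw [prod_ofFn_apply]
  simp only [rowMatrix, prod_ofFn_apply]
  unfold dualZ
  rw [sum_filter, ← (Labelling.equivProd n).symm.sum_comp, Fintype.sum_prod_type]
  refine sum_congr rfl fun V _ => ?_
  rw [prod_univ_sum, Fintype.piFinset_univ]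
  split_ifs with hV
  · refine sum_congr rfl fun h _ => ?_
    have hadm : Labelling.IsAdmissible σ w ((Labelling.equivProd n).symm (V, h)) ↔
        ∀ i, (h i 0 = some (w i) ∧ h i (Fin.last n) = none) ∧
          ∀ j, VertexOK (h i j.succ) (V i.castSucc j) (h i j.castSucc) (V i.succ j) :=
      ⟨fun hA i => ⟨⟨hA.2.1 i, hA.2.2.2.1 i⟩, hA.2.2.2.2 i⟩,
        fun hA => ⟨congrFun hV.1, fun i => (hA i).1.1, congrFun hV.2, fun i => (hA i).1.2,
          fun i => (hA i).2⟩⟩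
    simp only [vertexWeight, Matrix.of_apply, prod_ite_zero, ← ite_and, mem_univ, true_imp_iff]
    exact if_congr hadm rfl rfl
  · refine sum_eq_zero fun h _ => if_neg fun hA => hV ⟨?_, ?_⟩
    · exact funext hA.1
    · exact funext hA.2.2.1

-- By distributivity, the sum over the vertical labels between the rows is taken separately in each
-- column, so the two rows can be read as a product of column matrices.
open scoped Kronecker in
theorem rowMatrix_mul_rowMatrix (t x₁ x₂ : K) (y : Fin n → K) (r₁ r₂ : Fin n)
    (T B : Fin n → Finset (Fin n)) :
    (rowMatrix t x₁ y r₁ * rowMatrix t x₂ y r₂) T B =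
      (List.ofFn fun j => twoVertexWeight t x₁ x₂ (y j) (T j) (B j)).prod
        (some r₁, some r₂) (none, none) := by
  have h : ∀ j, twoVertexWeight t x₁ x₂ (y j) (T j) (B j) =
      ∑ S, (Matrix.of fun b a => vertexWeight t x₁ (y j) a (T j) b S) ⊗ₖ
        (Matrix.of fun b a => vertexWeight t x₂ (y j) a S b (B j)) := by
    intro j
    ext p q
    rw [Matrix.sum_apply]
    rfl
  simp only [h]
  rw [← sum_prod_ofFn fun j S => (Matrix.of fun b a => vertexWeight t x₁ (y j) a (T j) b S) ⊗ₖ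
        (Matrix.of fun b a => vertexWeight t x₂ (y j) a S b (B j)), Matrix.sum_apply,
    Matrix.mul_apply]
  refine sum_congr rfl fun V _ => ?_
  rw [← prod_ofFn_kronecker]
  rfl

/-- The train argument read at right labels `(r₁, r₂)` and empty left labels. On the empty pair the
R-matrix has no swap part, hence the single term on the right. -/
theorem rowMatrix_exchange {t x₁ x₂ : K} (ht : t ≠ 0) (h₁ : x₁ ≠ 0) (h₂ : x₂ ≠ 0)
    {y : Fin n → K} (hy : ∀ j, y j ≠ 0) {r₁ r₂ : Fin n} (hr : r₂ < r₁) :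
    (1 - t) • (rowMatrix t x₁ y r₁ * rowMatrix t x₂ y r₂) +
        (1 - x₂ / x₁) • (rowMatrix t x₁ y r₂ * rowMatrix t x₂ y r₁) =
      (1 - t * (x₁ / x₂)) • (rowMatrix t x₂ y r₁ * rowMatrix t x₁ y r₂) := by
  ext T B
  have h := mul_prod_ofFn (rMatrix n t x₁ x₂) fun j =>
    rMatrix_mul_twoVertexWeight ht h₁ h₂ (hy j) (T j) (B j)
  have h := congrFun (congrFun h (some r₁, some r₂)) (none, none)
  rw [rMatrix_mul_apply, mul_rMatrix_apply] at h
  simpa [rDiag, rSwap, hr, hr.ne', rowMatrix_mul_rowMatrix] using h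

/-- The exchange relation for partition functions. -/
theorem dualZ_exchange {t : K} (ht : t ≠ 0) {x y : Fin n → K} (hx : ∀ i, x i ≠ 0)
    (hy : ∀ j, y j ≠ 0) (σ w : Perm (Fin n)) {i j : Fin n} (hij : (i : ℕ) + 1 = j)
    (hw : w j < w i) :
    (1 - t) * dualZ t σ w x y + (1 - x j / x i) * dualZ t σ (w * swap i j) x y =
      (1 - t * (x i / x j)) * dualZ t σ w (x ∘ swap i j) y := by
  have hne : i ≠ j := fun h => by simp [h] at hij
  -- The rows other than `i` and `j` are the same in all three partition functions.
  obtain ⟨l, r, hlr⟩ := exists_prod_ofFn_eq (fun i => rowMatrix t (x i) y (w i)) hij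
  simp only [dualZ_eq_prod]
  rw [hlr _ fun k _ _ => rfl,
    hlr (fun k => rowMatrix t (x k) y ((w * swap i j) k)) fun k hi hj => by
      simp [swap_apply_of_ne_of_ne hi hj],
    hlr (fun k => rowMatrix t ((x ∘ swap i j) k) y (w k)) fun k hi hj => by
      simp [swap_apply_of_ne_of_ne hi hj]]
  have h := rowMatrix_exchange ht (hx i) (hx j) hy hw
  have h := congrArg (fun M => (l * M * r) (fun j => {σ j}) fun _ => ∅) h
  simpa [mul_add, add_mul] using h

end TransferMatrices

/-! ### Length, descents and uniqueness of the two families -/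

section Length

variable {n : ℕ}

theorem swap_lt_swap_of_adjacent {i j : Fin n} (hij : (i : ℕ) + 1 = j) {p q : Fin n} (hpq : p < q)
    (h : ¬ (p = i ∧ q = j)) : swap i j p < swap i j q := by
  rw [swap_apply_def, swap_apply_def]
  simp only [Fin.lt_def, Fin.ext_iff] at *
  split_ifs <;> omega

/-- An adjacent transposition preserves the order of every pair of positions except `(i, j)`. It
therefore matches the inversions of `w` with those of the product other than `(i, j)`. -/
theorem permLength_mul_swap {w : Perm (Fin n)} {i j : Fin n} (hij : (i : ℕ) + 1 = j)
    (hw : w i < w j) : permLength (w * swap i j) = permLength w + 1 := by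
  have hlt : i < j := by rw [Fin.lt_def]; omega
  have hmem : (i, j) ∈ univ.filter fun p : Fin n × Fin n =>
      p.1 < p.2 ∧ (w * swap i j) p.2 < (w * swap i j) p.1 := by
    rw [mem_filter]
    exact ⟨mem_univ _, hlt, by simpa using hw⟩
  have herase : (univ.filter fun p : Fin n × Fin n =>
        p.1 < p.2 ∧ (w * swap i j) p.2 < (w * swap i j) p.1).erase (i, j) =
      (univ.filter fun p : Fin n × Fin n => p.1 < p.2 ∧ w p.2 < w p.1).map
        (Equiv.prodCongr (swap i j) (swap i j)).toEmbedding := by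
    ext ⟨p, q⟩
    rw [mem_erase, mem_map_equiv, mem_filter, mem_filter]
    simp only [mem_univ, true_and, Perm.mul_apply,
      Equiv.prodCongr_symm, Equiv.symm_swap, Equiv.prodCongr_apply, Prod.map, ne_eq,
      Prod.mk.injEq]
    constructor
    · rintro ⟨h1, h2, h3⟩
      exact ⟨swap_lt_swap_of_adjacent hij h2 h1, h3⟩
    · rintro ⟨h2, h3⟩
      have h1 : ¬ (swap i j p = i ∧ swap i j q = j) := by
        rintro ⟨h, h'⟩
        rw [h, h'] at h3
        exact h3.not_gt hw
      refine ⟨?_, by simpa using swap_lt_swap_of_adjacent hij h2 h1, h3⟩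
      rintro ⟨rfl, rfl⟩
      rw [swap_apply_left, swap_apply_right] at h2
      exact h2.not_gt hlt
  rw [permLength, permLength, ← card_erase_add_one hmem, herase, card_map]

theorem permLength_lt_mul_swap_iff {w : Perm (Fin n)} {i j : Fin n} (hij : (i : ℕ) + 1 = j) :
    permLength w < permLength (w * swap i j) ↔ w i < w j := by
  have hne : i ≠ j := fun h => by simp [h] at hij
  constructor
  · intro h
    by_contra hc
    have hlt : w j < w i := lt_of_le_of_ne (not_lt.1 hc) (w.injective.ne hne.symm)
    have := permLength_mul_swap (w := w * swap i j) hij (by simpa using hlt)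
    rw [mul_swap_mul_self] at this
    omega
  · intro h
    rw [permLength_mul_swap hij h]; omega

theorem permLength_mul_swap_lt_iff {w : Perm (Fin n)} {i j : Fin n} (hij : (i : ℕ) + 1 = j) :
    permLength (w * swap i j) < permLength w ↔ w j < w i := by
  have := permLength_lt_mul_swap_iff (w := w * swap i j) hij
  rw [mul_swap_mul_self] at this
  simpa using this

theorem longest_mul_lt_iff (w : Perm (Fin n)) (i j : Fin n) :
    (longest n * w) i < (longest n * w) j ↔ w j < w i := by
  simp [longest]

theorem longest_mul_longest : longest n * longest n = 1 := by
  ext i; simp [longest]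

theorem eq_one_of_lt_adjacent {w : Perm (Fin n)}
    (h : ∀ i j : Fin n, (i : ℕ) + 1 = j → w i < w j) : w = 1 := by
  have hw : StrictMono w := by
    cases n with
    | zero => exact fun i => i.elim0
    | succ n => exact Fin.strictMono_iff_lt_succ.2 fun i => h _ _ (by simp)
  have := (StrictMono.range_inj hw strictMono_id).1 (by simp [w.surjective.range_eq])
  ext i; simp [this]

theorem eq_longest_of_gt_adjacent {w : Perm (Fin n)}
    (h : ∀ i j : Fin n, (i : ℕ) + 1 = j → w j < w i) : w = longest n := by
  have h1 : longest n * w = 1 :=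
    eq_one_of_lt_adjacent fun i j hij => (longest_mul_lt_iff w i j).2 (h i j hij)
  rw [← mul_one (longest n), ← h1, ← mul_assoc, longest_mul_longest, one_mul]

theorem permLength_le (w : Perm (Fin n)) : permLength w ≤ Fintype.card (Fin n × Fin n) :=
  card_le_univ _

/-- Any `w ≠ 1` has an adjacent descent, and the recursion then computes the value at `w` from a
shorter permutation. -/
theorem IsMotivicX.unique {F G : Perm (Fin n) → RatFun n} (hF : IsMotivicX F)
    (hG : IsMotivicX G) : F = G := by
  have key : ∀ (k : ℕ) (w : Perm (Fin n)), permLength w = k → F w = G w := by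
    intro k
    induction k using Nat.strong_induction_on with
    | _ k ih =>
      intro w hk
      by_cases h : ∀ i j : Fin n, (i : ℕ) + 1 = j → w i < w j
      · rw [eq_one_of_lt_adjacent h, hF.base, hG.base]
      · push Not at h
        obtain ⟨i, j, hij, hji⟩ := h
        have hne : i ≠ j := fun h => by simp [h] at hij
        have hlt := (permLength_mul_swap_lt_iff hij).2
          (lt_of_le_of_ne hji (w.injective.ne hne.symm))
        have h1 := hF.step (w * swap i j) i j hij (by rwa [mul_swap_mul_self])
        have h2 := hG.step (w * swap i j) i j hij (by rwa [mul_swap_mul_self])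
        rw [mul_swap_mul_self] at h1 h2
        rw [h1, h2, ih _ (hk ▸ hlt) _ rfl]
  exact funext fun w => key _ w rfl

theorem IsMotivicY.unique {F G : Perm (Fin n) → RatFun n} (hF : IsMotivicY F)
    (hG : IsMotivicY G) : F = G := by
  have key : ∀ (k : ℕ) (w : Perm (Fin n)),
      -- The recursion now lowers the length, so the induction is on colength; any upper bound for
      -- the length serves.
      Fintype.card (Fin n × Fin n) - permLength w = k → F w = G w := by
    intro k
    induction k using Nat.strong_induction_on with
    | _ k ih =>
      intro w hk
      by_cases h : ∀ i j : Fin n, (i : ℕ) + 1 = j → w j < w i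
      · rw [eq_longest_of_gt_adjacent h, hF.base, hG.base]
      · push Not at h
        obtain ⟨i, j, hij, hji⟩ := h
        have hne : i ≠ j := fun h => by simp [h] at hij
        have hlt := (permLength_lt_mul_swap_iff hij).2
          (lt_of_le_of_ne hji (w.injective.ne hne))
        have h1 := hF.step (w * swap i j) i j hij (by rwa [mul_swap_mul_self])
        have h2 := hG.step (w * swap i j) i j hij (by rwa [mul_swap_mul_self])
        rw [mul_swap_mul_self] at h1 h2
        have hle := permLength_le (w * swap i j)
        rw [h1, h2, ih _ (by omega) _ rfl]
  exact funext fun w => key _ w rfl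

end Length

/-! ### The unique state for the longest permutation -/

section FrozenState

variable {n : ℕ}

/-- The only admissible state for the longest permutation. -/
def frozenState (n : ℕ) : Labelling n where
  vert i j := if (j : ℕ) + i < n then {j} else ∅
  horiz i k := if (k : ℕ) + i < n then some i.rev else none

theorem frozenState_isAdmissible : (frozenState n).IsAdmissible 1 (longest n) := by
  refine ⟨fun j => by simp [frozenState], fun i => by simp [frozenState, longest],
    fun j => by simp [frozenState], fun i => by simp [frozenState], fun i j => ?_⟩
  rcases lt_trichotomy ((j : ℕ) + i + 1) n with h | h | h
  · have h1 : (j : ℕ) + i < n := by omega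
    have h2 : (j : ℕ) + 1 + i < n := by omega
    have h3 : (j : ℕ) + (i + 1) < n := by omega
    simp [frozenState, VertexOK, h1, h2, h3]
  · have h1 : (j : ℕ) + i < n := by omega
    have h2 : ¬ (j : ℕ) + 1 + i < n := by omega
    have h3 : ¬ (j : ℕ) + (i + 1) < n := by omega
    have h4 : i.rev = j := by ext; simp; omega
    simp [frozenState, VertexOK, h1, h2, h3, h4]
  · have h1 : ¬ (j : ℕ) + i < n := by omega
    have h2 : ¬ (j : ℕ) + 1 + i < n := by omega
    have h3 : ¬ (j : ℕ) + (i + 1) < n := by omega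
    simp [frozenState, VertexOK, h1, h2, h3]

/-- The row is forced from both ends. From the right, its color continues leftwards until it meets
the column with the same top color; from the left, a vertex with no color on its left and top edges
has none on its right. -/
theorem row_eq_frozenState {s : Labelling n} (hs : s.IsAdmissible 1 (longest n)) (i : Fin n)
    (hi : ∀ j, s.vert i.castSucc j = (frozenState n).vert i.castSucc j) :
    (∀ k, s.horiz i k = (frozenState n).horiz i k) ∧
      ∀ j, s.vert i.succ j = (frozenState n).vert i.succ j := by
  obtain ⟨-, hr, -, hl, hv⟩ := hs
  have hi : ∀ j : Fin n, s.vert i.castSucc j = if (j : ℕ) + i < n then {j} else ∅ := hi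
  have hv := hv i
  have h1 : ∀ k : Fin (n + 1), (k : ℕ) + i < n → s.horiz i k = some i.rev := by
    intro k
    induction k using Fin.induction with
    | zero => intro _; rw [hr]; simp [longest]
    | succ j ih =>
      intro hj
      simp only [Fin.val_succ] at hj
      have hj' : (j : ℕ) + i < n := by omega
      have hne : i.rev ≠ j := fun h => by
        have := congrArg Fin.val h
        simp at this; omega
      have h := hv j
      rw [ih (by simpa using hj'), hi j, if_pos hj'] at h
      cases ha : s.horiz i j.succ with
      | none => simp [ha, VertexOK, hne] at h
      | some a =>
        simp only [ha, VertexOK, mem_singleton, hne, false_and, and_false, or_false] at h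
        rw [h.1]
  have h2 : ∀ k : Fin (n + 1), n ≤ (k : ℕ) + i → s.horiz i k = none := by
    intro k
    induction k using Fin.reverseInduction with
    | last => intro _; exact hl i
    | cast j ih =>
      intro hj
      simp only [Fin.val_castSucc] at hj
      have h := hv j
      rw [ih (by simp; omega), hi j, if_neg (by omega)] at h
      cases ha : s.horiz i j.castSucc with
      | none => rfl
      | some a => simp [ha, VertexOK] at h
  have h3 : ∀ k, s.horiz i k = (frozenState n).horiz i k := by
    intro k
    by_cases hk : (k : ℕ) + i < n
    · simp [frozenState, hk, h1 k hk]
    · simp [frozenState, hk, h2 k (not_lt.1 hk)]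
  refine ⟨h3, fun j => ?_⟩
  have h := hv j
  have h' := (frozenState_isAdmissible (n := n)).2.2.2.2 i j
  rw [h3, h3, hi j] at h
  rw [vertexOK_iff] at h h'
  rw [h.2, h'.2]
  simp [frozenState]

theorem isAdmissible_longest_iff {s : Labelling n} :
    s.IsAdmissible 1 (longest n) ↔ s = frozenState n := by
  refine ⟨fun hs => ?_, fun h => h ▸ frozenState_isAdmissible⟩
  have hv : ∀ i j, s.vert i j = (frozenState n).vert i j := by
    intro i
    induction i using Fin.induction with
    | zero => intro j; rw [hs.1]; simp [frozenState]
    | succ i ih => exact (row_eq_frozenState hs i ih).2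
  have hh : ∀ i k, s.horiz i k = (frozenState n).horiz i k := fun i =>
    (row_eq_frozenState hs i (hv _)).1
  rcases s with ⟨v, h⟩
  have e1 : v = (frozenState n).vert := by funext i j; exact hv i j
  have e2 : h = (frozenState n).horiz := by funext i j; exact hh i j
  rw [e1, e2]

/-- Reflecting the second position identifies the inversions with the crossings of the frozen state,
each of which contributes one sign. -/
theorem permLength_longest :
    permLength (longest n) =
      (univ.filter fun p : Fin n × Fin n => ((p.1 : ℕ) + 1) + ((p.2 : ℕ) + 1) ≤ n).card := by
  unfold permLength
  rw [← card_map (Equiv.prodCongr (Equiv.refl (Fin n)) (longest n)).toEmbedding]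
  congr 1
  ext ⟨p, q⟩
  simp only [mem_filter, mem_univ, true_and, mem_map_equiv, Equiv.prodCongr_symm,
    Equiv.prodCongr_apply, Prod.map, longest, Fin.revPerm_symm, Fin.revPerm_apply, Equiv.refl_symm,
    Equiv.refl_apply, Fin.lt_def, Fin.val_rev]
  omega

/-- The partition function for the longest permutation. -/
theorem dualZ_longest {K : Type*} [Field K] (t : K) {x y : Fin n → K} (hx : ∀ i, x i ≠ 0) :
    dualZ t 1 (longest n) x y = (-1) ^ permLength (longest n) *
      ∏ p : Fin n × Fin n with ((p.1 : ℕ) + 1) + ((p.2 : ℕ) + 1) ≤ n, (1 - x p.1 / y p.2) := by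
  have h : (univ.filter fun s : Labelling n => s.IsAdmissible 1 (longest n)) = {frozenState n} := by
    ext s; simp [isAdmissible_longest_iff]
  rw [dualZ, h, sum_singleton, permLength_longest, ← prod_const, ← prod_mul_distrib, prod_filter,
    Fintype.prod_prod_type]
  refine prod_congr rfl fun i _ => prod_congr rfl fun j _ => ?_
  -- Strictly before the antidiagonal two colors cross with weight `-(1 - x / y)`; on it a color
  -- turns, and beyond it all edges are empty, both with weight `1`.
  rcases lt_trichotomy ((j : ℕ) + i + 1) n with h | h | h
  · have h1 : (j : ℕ) + i < n := by omega
    have h2 : (j : ℕ) + 1 + i < n := by omega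
    have h3 : (i : ℕ) + 1 + (j + 1) ≤ n := by omega
    have h4 : ¬ i.rev < j := by simp [Fin.lt_def]; omega
    have h5 : i.rev ≠ j := fun h => by
      have := congrArg Fin.val h
      simp at this; omega
    have := hx i
    simp [frozenState, dualWeight, above, filter_singleton, h1, h2, h3, h4, h5]
    field_simp
    ring
  · have h1 : (j : ℕ) + i < n := by omega
    have h2 : ¬ (j : ℕ) + 1 + i < n := by omega
    have h3 : ¬ (i : ℕ) + 1 + (j + 1) ≤ n := by omega
    have h4 : i.rev = j := by ext; simp; omega
    simp [frozenState, dualWeight, above, below, filter_singleton, h1, h2, h3, h4]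
  · have h1 : ¬ (j : ℕ) + i < n := by omega
    have h2 : ¬ (j : ℕ) + 1 + i < n := by omega
    have h3 : ¬ (i : ℕ) + 1 + (j + 1) ≤ n := by omega
    simp [frozenState, dualWeight, h1, h2, h3]

end FrozenState

/-! ### The partition functions as motivic Chern classes -/

section Motivic

theorem map_dualZ {K L : Type*} [Field K] [Field L] (φ : K →+* L) {n : ℕ} (t : K)
    (σ w : Perm (Fin n)) (x y : Fin n → K) :
    φ (dualZ t σ w x y) = dualZ (φ t) σ w (φ ∘ x) (φ ∘ y) := by
  have h : ∀ (x y : K) (a : Option (Fin n)) (S : Finset (Fin n)) (b : Option (Fin n)),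
      φ (dualWeight t x y a S b) = dualWeight (φ t) (φ x) (φ y) a S b := by
    intro x y a S b
    rcases a with _ | a <;> rcases b with _ | b <;> simp only [dualWeight] <;>
      (try split_ifs) <;> simp
  simp [dualZ, h]

/-- Supplies the Laurent property, which the recursion does not show because `opT` has denominators.
-/
theorem dualZ_mem {k K : Type*} [Field k] [Field K] [Algebra k K] (A : Subalgebra k K) {n : ℕ}
    {t : K} (ht : t ∈ A) {x y : Fin n → K} (hx : ∀ i, x i ∈ A) (hx' : ∀ i, (x i)⁻¹ ∈ A)
    (hy : ∀ j, (y j)⁻¹ ∈ A) (σ w : Perm (Fin n)) : dualZ t σ w x y ∈ A := by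
  refine sum_mem fun s _ => prod_mem fun i _ => prod_mem fun j _ => ?_
  have h1 : (-1 : K) ∈ A := neg_mem (one_mem A)
  have hp : ∀ {z : K} (m : ℕ), z ∈ A → z ^ m ∈ A := fun m h => pow_mem h m
  have htx : -t * x i ∈ A := mul_mem (neg_mem ht) (hx i)
  have ht1 : t - 1 ∈ A := sub_mem ht (one_mem A)
  have hp' := fun m => hp m (neg_mem ht)
  generalize s.horiz i j.succ = a
  generalize s.horiz i j.castSucc = b
  rcases a with _ | a <;> rcases b with _ | b <;> simp only [dualWeight]
  · exact hp _ htx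
  · exact mul_mem (mul_mem (hp' _) (hp _ ht)) (hp _ (hx i))
  · exact mul_mem (mul_mem (mul_mem ht1 (hx' i)) (hp' _)) (hp _ (hx i))
  · split_ifs
    · exact mul_mem (mul_mem (hp _ ht) (hp _ (hx i)))
        (add_mem (neg_mem (hx' i)) (mul_mem (hp _ ht) (hy j)))
    · exact mul_mem (mul_mem (hp _ ht) (hp _ (hx i)))
        (add_mem (neg_mem (hx' i)) (mul_mem (hp _ ht) (hy j)))
    · exact mul_mem (mul_mem (mul_mem (mul_mem ht1 (hx' i)) (hp' _)) (hp _ ht)) (hp _ (hx i))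
    · exact mul_mem (mul_mem (mul_mem (mul_mem ht1 (hy j)) (hp _ h1)) (hp _ ht)) (hp _ (hx i))

variable {n : ℕ}

theorem tVar_ne_zero : tVar n ≠ 0 := by
  simp [tVar, MvPolynomial.X_ne_zero]

theorem xVar_ne_zero (i : Fin n) : xVar i ≠ 0 := by
  simp [xVar, MvPolynomial.X_ne_zero]

theorem yVar_ne_zero (j : Fin n) : yVar j ≠ 0 := by
  simp [yVar, MvPolynomial.X_ne_zero]

theorem xVar_injective : Function.Injective (xVar (n := n)) := by
  intro i j h
  have := MvPolynomial.X_injective (R := ℂ) (IsFractionRing.injective _ _ h)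
  simpa using this

/-- The signed partition function with column parameters `y_{τ(1)}, …, y_{τ(n)}`. -/
noncomputable def signedZ (τ w : Perm (Fin n)) : RatFun n :=
  (-1) ^ permLength (longest n) * dualZ (tVar n) 1 w xVar fun j => yVar (τ j)

theorem signedZ_mem_laurent (τ w : Perm (Fin n)) : signedZ τ w ∈ laurent n := by
  refine mul_mem (pow_mem (neg_mem (one_mem _)) _) (dualZ_mem _ ?_ ?_ ?_ ?_ _ _)
  all_goals
    intros
    exact Algebra.subset_adjoin (by simp)

theorem signedZ_longest (τ : Perm (Fin n)) :
    signedZ τ (longest n) = ∏ p : Fin n × Fin n with ((p.1 : ℕ) + 1) + ((p.2 : ℕ) + 1) ≤ n,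
      (1 - xVar p.1 / yVar (τ p.2)) := by
  rw [signedZ, dualZ_longest _ xVar_ne_zero, ← mul_assoc, ← mul_pow]
  simp

theorem signedZ_mul_swap (τ w : Perm (Fin n)) {i j : Fin n} (hij : (i : ℕ) + 1 = j)
    (hw : w j < w i) : signedZ τ (w * swap i j) = opT i j (signedZ τ w) := by
  have hne : i ≠ j := fun h => by simp [h] at hij
  have hx : xVar j - xVar i ≠ 0 := sub_ne_zero.2 fun h => hne (xVar_injective h).symm
  have hx' : xVar i - xVar j ≠ 0 := sub_ne_zero.2 fun h => hne (xVar_injective h)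
  have hi := xVar_ne_zero i
  have hj := xVar_ne_zero j
  have hact : xAct (swap i j) (signedZ τ w) = (-1) ^ permLength (longest n) *
      dualZ (tVar n) 1 w (xVar ∘ swap i j) fun j => yVar (τ j) := by
    rw [signedZ, map_mul, map_pow, map_neg, map_one]
    congr 1
    have h := map_dualZ ((xAct (swap i j)).toRingEquiv.toRingHom) (tVar n) 1 w xVar
      fun j => yVar (τ j)
    refine h.trans ?_
    congr 1
    · exact xAct_tVar _
    · funext k; exact xAct_xVar _ _
    · funext k; exact xAct_yVar _ _
  have h := dualZ_exchange tVar_ne_zero xVar_ne_zero (fun k => yVar_ne_zero (τ k)) 1 w hij hw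
  rw [opT, hact]
  -- Clearing this common denominator of `opT` leaves the exchange relation.
  have hd : 1 - (xVar i / xVar j)⁻¹ ≠ 0 := by
    rw [inv_div, one_sub_div hi]
    exact div_ne_zero hx' hi
  rw [div_mul_eq_mul_div, div_mul_eq_mul_div, ← add_div, eq_div_iff hd, inv_div, signedZ, signedZ]
  linear_combination (-1) ^ permLength (longest n) * h

theorem isMotivicY_signedZ : IsMotivicY (n := n) (signedZ 1) where
  mem_laurent := signedZ_mem_laurent 1
  base := signedZ_longest 1
  step w _ _ hij h := signedZ_mul_swap 1 w hij ((permLength_mul_swap_lt_iff hij).1 h)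

/-- Left multiplication by `w₀` turns ascents into descents, and reflecting the column index turns
the region `i + j ≤ n` of the initial product into `i < j`. -/
theorem isMotivicX_signedZ :
    IsMotivicX (n := n) fun w => signedZ (longest n) (longest n * w) where
  mem_laurent w := signedZ_mem_laurent _ _
  base := by
    rw [mul_one, signedZ_longest]
    refine prod_equiv (Equiv.prodCongr (Equiv.refl (Fin n)) (longest n)) ?_ ?_
    · rintro ⟨p, q⟩
      simp only [mem_filter, mem_univ, true_and, Equiv.prodCongr_apply, Prod.map, longest,
        Fin.revPerm_apply, Equiv.refl_apply, Fin.lt_def, Fin.val_rev]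
      omega
    · rintro ⟨p, q⟩ _
      rfl
  step w i j hij h := by
    rw [← mul_assoc]
    exact signedZ_mul_swap _ _ hij
      ((longest_mul_lt_iff w j i).2 ((permLength_lt_mul_swap_iff hij).1 h))

end Motivic

end MotivicLattice

theorem corollary5p6 (n : ℕ) :
    (∃! F : Equiv.Perm (Fin n) → MotivicLattice.RatFun n, MotivicLattice.IsMotivicX F) ∧
    (∃! F : Equiv.Perm (Fin n) → MotivicLattice.RatFun n, MotivicLattice.IsMotivicY F) ∧
    (∀ MCX : Equiv.Perm (Fin n) → MotivicLattice.RatFun n, MotivicLattice.IsMotivicX MCX →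
      ∀ w : Equiv.Perm (Fin n),
        MCX w = (-1) ^ MotivicLattice.permLength (MotivicLattice.longest n) *
          MotivicLattice.dualZ (MotivicLattice.tVar n) 1 (MotivicLattice.longest n * w)
            MotivicLattice.xVar (fun j => MotivicLattice.yVar (MotivicLattice.longest n j))) ∧
    (∀ MCY : Equiv.Perm (Fin n) → MotivicLattice.RatFun n, MotivicLattice.IsMotivicY MCY →
      ∀ w : Equiv.Perm (Fin n),
        MCY w = (-1) ^ MotivicLattice.permLength (MotivicLattice.longest n) *
          MotivicLattice.dualZ (MotivicLattice.tVar n) 1 w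
            MotivicLattice.xVar MotivicLattice.yVar) :=
  ⟨⟨_, MotivicLattice.isMotivicX_signedZ, fun _ h => h.unique MotivicLattice.isMotivicX_signedZ⟩,
    ⟨_, MotivicLattice.isMotivicY_signedZ, fun _ h => h.unique MotivicLattice.isMotivicY_signedZ⟩,
    fun _ h => congrFun (h.unique MotivicLattice.isMotivicX_signedZ),
    fun _ h => congrFun (h.unique MotivicLattice.isMotivicY_signedZ)⟩
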